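/- Let $T$ be a tree on $n \ge 2$ vertices with matching number $\beta$ (the maximum number of pairwise disjoint edges), and let $$H(T)=\sum_{\{u,v\}} \frac{1}{d(u,v)}$$ be its Harary index, where the sum runs over all unordered pairs of distinct vertices of $T$ and $d$ is the graph distance. Then $$H(T)\leq \frac{1}{24}\left(6n^2-4\beta n+\beta^2+9\beta+10n-22\right),$$ with equality if and only if $T\cong A_{n,n-\beta}$. Here, for $\frac{n-1}{2}<m\leq n-1$, the spur $A_{n,m}$ is the tree on $n$ vertices obtained from the star with $m$ pendent vertices by adding one pendent edge to each of $n-m-1$ of these pendent vertices. -/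

import Mathlib

namespace SimpleGraph

/-- The Harary index `H(G) = ∑_{{u, v}} 1 / d(u, v)` over unordered pairs of distinct vertices, as
the half-sum of the entries of the reciprocal distance matrix. The diagonal entries of that matrix
are `0`, which is the value of `1 / 0` here, since `d(u, u) = 0`. -/
noncomputable def hararyIndex {V : Type*} [Fintype V] (G : SimpleGraph V) : ℝ :=
  (1 / 2) * ∑ u : V, ∑ v : V, 1 / (G.dist u v : ℝ)

/-- The matching number of a finite graph: the largest number of edges in a matching. -/
noncomputable def matchingNumber {V : Type*} [Finite V] (G : SimpleGraph V) : ℕ :=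
  sSup {k : ℕ | ∃ M : G.Subgraph, M.IsMatching ∧ M.edgeSet.ncard = k}

/-- The spur `A_{n,m}` for `(n - 1) / 2 < m ≤ n - 1`. Vertex `0` is the center of a star with the
pendent vertices `1, …, m`; each remaining vertex `m + i`, for `1 ≤ i ≤ n - m - 1`, is attached by
a pendent edge to the pendent vertex `i` of that star. -/
def spur (n m : ℕ) : SimpleGraph (Fin n) :=
  SimpleGraph.fromRel fun a b : Fin n =>
    (a.val = 0 ∧ 1 ≤ b.val ∧ b.val ≤ m) ∨ (1 ≤ a.val ∧ a.val ≤ m ∧ b.val = m + a.val)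

end SimpleGraph

namespace SimpleGraph

section Distance

variable {V : Type*} {T : SimpleGraph V}

lemma IsTree.dist_eq_length_of_isPath (hT : T.IsTree) {x y : V} (p : T.Walk x y)
    (hp : p.IsPath) : T.dist x y = p.length := by
  obtain ⟨q, hq, hql⟩ := hT.connected.exists_path_of_dist x y
  rw [← hql, (hT.existsUnique_path x y).unique hp hq]

lemma Connected.exists_adj_dist_add_one (hT : T.Connected) {x y : V} (h : x ≠ y) :
    ∃ z, T.Adj x z ∧ T.dist z y + 1 = T.dist x y := by
  obtain ⟨p, hp⟩ := hT.exists_walk_length_eq_dist x y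
  cases p with
  | nil => exact absurd rfl h
  | @cons _ z _ hxz q =>
    refine ⟨z, hxz, le_antisymm ?_ ?_⟩
    · rw [← hp, Walk.length_cons]
      exact Nat.succ_le_succ (dist_le q)
    · obtain ⟨q', hq'⟩ := hT.exists_walk_length_eq_dist z y
      rw [← hq', ← Walk.length_cons hxz]
      exact dist_le _

/-- In a tree, the neighbour of `x` on the way to `r` is unique. -/
lemma IsTree.eq_of_adj_of_dist_add_one (hT : T.IsTree) {r x y z : V} (hy : T.Adj x y)
    (hz : T.Adj x z) (hyr : T.dist y r + 1 = T.dist x r) (hzr : T.dist z r + 1 = T.dist x r) :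
    y = z := by
  obtain ⟨p, hp⟩ := hT.connected.exists_walk_length_eq_dist y r
  obtain ⟨q, hq⟩ := hT.connected.exists_walk_length_eq_dist z r
  have hp' : (Walk.cons hy p).IsPath := Walk.isPath_of_length_eq_dist _ (by simp [hp, hyr])
  have hq' : (Walk.cons hz q).IsPath := Walk.isPath_of_length_eq_dist _ (by simp [hq, hzr])
  have := congrArg Walk.snd ((hT.existsUnique_path x r).unique hp' hq')
  simpa using this

lemma IsTree.dist_add_one_of_adj (hT : T.IsTree) (r : V) {x y : V} (h : T.Adj x y) :
    T.dist x r = T.dist y r + 1 ∨ T.dist y r = T.dist x r + 1 := by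
  rw [T.dist_comm (u := x), T.dist_comm (u := y)]
  exact hT.dist_eq_dist_add_one_of_adj r h

lemma IsTree.not_adj_of_common_neighbor (hT : T.IsTree) {x y z : V} (hxy : T.Adj x y)
    (hxz : T.Adj x z) : ¬ T.Adj y z := by
  intro h
  have := hT.dist_ne_of_adj x h
  rw [dist_eq_one_iff_adj.2 hxy, dist_eq_one_iff_adj.2 hxz] at this
  exact this rfl

/-- Distances from a leaf `v` with neighbour `u`. -/
lemma Connected.dist_of_leaf (hT : T.Connected) {u v x : V} (hv : ∀ y, T.Adj v y ↔ y = u)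
    (hx : x ≠ v) : T.dist v x = T.dist u x + 1 := by
  obtain ⟨z, hz, hzx⟩ := hT.exists_adj_dist_add_one hx.symm
  rw [hv] at hz
  rw [← hzx, hz]

lemma IsTree.induce_compl_leaf (hT : T.IsTree) {u v : V} (hv : ∀ y, T.Adj v y ↔ y = u) :
    (T.induce {v}ᶜ).IsTree := by
  have hu : T.Adj v u := (hv u).2 rfl
  have : Nonempty ({v}ᶜ : Set V) := ⟨⟨u, hu.ne'⟩⟩
  refine ⟨⟨hT.connected.preconnected.induce_of_degree_eq_one ?_⟩, hT.isAcyclic.induce _⟩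
  intro x hx
  obtain rfl : x = v := by simpa using hx
  intro y hy z hz
  rw [(hv y).1 hy, (hv z).1 hz]

lemma IsTree.dist_induce (hT : T.IsTree) {s : Set V} (hs : (T.induce s).IsTree) (x y : s) :
    (T.induce s).dist x y = T.dist x y := by
  obtain ⟨p, hp, hpl⟩ := hs.connected.exists_path_of_dist x y
  have := hT.dist_eq_length_of_isPath (p.map (Embedding.induce s).toHom)
    (hp.map (Embedding.induce (G := T) s).injective)
  rw [Walk.length_map, hpl] at this
  exact this.symm

/-- A vertex farthest from `r` in a nontrivial tree is a leaf. -/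
lemma IsTree.exists_leaf_of_forall_dist_le (hT : T.IsTree) [Nontrivial V] {r v : V}
    (hv : ∀ x, T.dist x r ≤ T.dist v r) : ∃ u, ∀ y, T.Adj v y ↔ y = u := by
  have hvr : v ≠ r := by
    rintro rfl
    obtain ⟨x, hx⟩ := exists_ne v
    have := hv x
    rw [dist_self, Nat.le_zero, hT.connected.dist_eq_zero_iff] at this
    exact hx this
  obtain ⟨u, hu, hur⟩ := hT.connected.exists_adj_dist_add_one hvr
  refine ⟨u, fun y => ⟨fun hy => ?_, fun hy => hy ▸ hu⟩⟩
  refine hT.eq_of_adj_of_dist_add_one hy hu ?_ hur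
  have := hv y
  rcases hT.dist_add_one_of_adj r hy with h | h <;> omega

/-- A tree on at least three vertices has a leaf `v`, with neighbour `u`, such that either another
leaf is adjacent to `u`, or `u` has exactly one further neighbour and that one is not a leaf. -/
lemma IsTree.exists_twin_leaf_or_pendant_path (hT : T.IsTree) [Finite V] (h3 : 3 ≤ Nat.card V) :
    ∃ u v, (∀ y, T.Adj v y ↔ y = u) ∧
      ((∃ x, x ≠ v ∧ ∀ y, T.Adj x y ↔ y = u) ∨
        ∃ w, w ≠ v ∧ (∀ y, T.Adj u y ↔ y = v ∨ y = w) ∧ ∃ x, x ≠ u ∧ T.Adj w x) := by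
  have : Nontrivial V := Finite.one_lt_card_iff_nontrivial.1 (by omega)
  obtain ⟨r⟩ : Nonempty V := inferInstance
  obtain ⟨v, hv⟩ := Finite.exists_max (fun x => T.dist x r)
  obtain ⟨u, hu⟩ := hT.exists_leaf_of_forall_dist_le hv
  have huv : T.Adj u v := ((hu u).2 rfl).symm
  refine ⟨u, v, hu, or_iff_not_imp_left.2 fun htwin => ?_⟩
  push Not at htwin
  have hleaf : ∀ x, T.Adj u x → x ≠ v → ¬ ∃ z, ∀ y, T.Adj x y ↔ y = z := by
    rintro x hx hxv ⟨z, hz⟩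
    obtain rfl := (hz u).1 hx.symm
    obtain ⟨y, hy⟩ := htwin x hxv
    rcases hy with hy | hy
    · exact hy.2 ((hz y).1 hy.1)
    · exact hy.1 ((hz y).2 hy.2)
  have hparent : ∀ x, T.Adj u x → x ≠ v → T.dist x r + 1 = T.dist u r := by
    intro x hx hxv
    rcases hT.dist_add_one_of_adj r hx with h | h
    · exact h.symm
    · refine absurd (hT.exists_leaf_of_forall_dist_le (r := r) (v := x) fun y => ?_) (hleaf x hx hxv)
      have := hv y
      have := hv x
      rcases hT.dist_add_one_of_adj r huv with h' | h' <;> omega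
  obtain ⟨w, hw, hwv⟩ : ∃ w, T.Adj u w ∧ w ≠ v := by
    by_contra! hcon
    obtain ⟨x, hx⟩ : ∃ x, x ∉ ({u, v} : Set V) := by
      by_contra! hall
      have h2 : Nat.card V ≤ 2 := by
        rw [← Set.ncard_univ, ← Set.eq_univ_of_forall hall]
        exact (Set.ncard_insert_le u {v}).trans_eq (by rw [Set.ncard_singleton])
      omega
    simp only [Set.mem_insert_iff, Set.mem_singleton_iff, not_or] at hx
    obtain ⟨z, hz, hzx⟩ := hT.connected.exists_adj_dist_add_one (Ne.symm hx.1)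
    have h1 := hT.connected.dist_of_leaf hu hx.2
    rw [hcon z hz] at hzx
    omega
  refine ⟨w, hwv, fun y => ⟨fun hy => ?_, ?_⟩, ?_⟩
  · by_cases hyv : y = v
    · exact Or.inl hyv
    · exact Or.inr (hT.eq_of_adj_of_dist_add_one hy hw (hparent y hy hyv) (hparent w hw hwv))
  · rintro (rfl | rfl) <;> assumption
  · by_contra! hcon
    refine hleaf w hw hwv ⟨u, fun y => ⟨fun hy => ?_, fun hy => hy ▸ hw.symm⟩⟩
    by_contra hyu
    exact hcon y hyu hy

end Distance

section Matching

variable {V : Type*} {T : SimpleGraph V} {b : ℕ}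

/-- The edges `f i — g i` of `G` are pairwise disjoint. -/
structure IsIndexedMatching {ι : Type*} (G : SimpleGraph V) (f g : ι → V) : Prop where
  adj : ∀ i, G.Adj (f i) (g i)
  left_injective : ∀ i j, f i = f j → i = j
  right_injective : ∀ i j, g i = g j → i = j
  ne : ∀ i j, f i ≠ g j

/-- `G` has `b` pairwise disjoint edges within the vertex set `s`. -/
def HasMatchingOn (G : SimpleGraph V) (s : Set V) (b : ℕ) : Prop :=
  ∃ f g : Fin b → V, G.IsIndexedMatching f g ∧ ∀ i, f i ∈ s ∧ g i ∈ s

/-- `G` has `b` pairwise disjoint edges. -/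
def HasMatching (G : SimpleGraph V) (b : ℕ) : Prop :=
  ∃ f g : Fin b → V, G.IsIndexedMatching f g

lemma HasMatchingOn.induce {s : Set V} (h : T.HasMatchingOn s b) :
    (T.induce s).HasMatching b := by
  obtain ⟨f, g, h, hs⟩ := h
  refine ⟨fun i => ⟨f i, (hs i).1⟩, fun i => ⟨g i, (hs i).2⟩, ⟨fun i => h.adj i, ?_, ?_, ?_⟩⟩
  · intro i j hij
    exact h.left_injective i j (Subtype.ext_iff.1 hij)
  · intro i j hij
    exact h.right_injective i j (Subtype.ext_iff.1 hij)
  · intro i j hij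
    exact h.ne i j (Subtype.ext_iff.1 hij)

lemma HasMatchingOn.induce_of_subset {s t : Set V} (h : T.HasMatchingOn t b) (hst : t ⊆ s) :
    (T.induce s).HasMatchingOn (Subtype.val ⁻¹' t) b := by
  obtain ⟨f, g, h, ht⟩ := h
  refine ⟨fun i => ⟨f i, hst (ht i).1⟩, fun i => ⟨g i, hst (ht i).2⟩,
    ⟨fun i => h.adj i, ?_, ?_, ?_⟩, ht⟩
  · intro i j hij
    exact h.left_injective i j (Subtype.ext_iff.1 hij)
  · intro i j hij
    exact h.right_injective i j (Subtype.ext_iff.1 hij)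
  · intro i j hij
    exact h.ne i j (Subtype.ext_iff.1 hij)

lemma Adj.hasMatching_one {x y : V} (h : T.Adj x y) : T.HasMatching 1 :=
  ⟨fun _ => x, fun _ => y, fun _ => h, fun _ _ _ => Subsingleton.elim _ _,
    fun _ _ _ => Subsingleton.elim _ _, fun _ _ => h.ne⟩

lemma Connected.hasMatching_one [Nontrivial V] (hT : T.Connected) : T.HasMatching 1 := by
  obtain ⟨x, y, hxy⟩ := exists_pair_ne V
  obtain ⟨z, hz, -⟩ := hT.exists_adj_dist_add_one hxy
  exact hz.hasMatching_one

lemma HasMatching.two_mul_le [Fintype V] (h : T.HasMatching b) : 2 * b ≤ Fintype.card V := by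
  obtain ⟨f, g, h⟩ := h
  have := Fintype.card_le_of_injective (Sum.elim f g)
    (Function.Injective.sumElim h.left_injective h.right_injective h.ne)
  simp only [Fintype.card_sum, Fintype.card_fin] at this
  omega

/-- The edges of a matching in a tree can be oriented such that no tail is adjacent to `u`. -/
lemma IsIndexedMatching.exists_not_adj {ι : Type*} {f g : ι → V}
    (h : T.IsIndexedMatching f g) (hT : T.IsTree) (u : V) :
    ∃ q p : ι → V, T.IsIndexedMatching q p ∧ ∀ i, ¬ T.Adj u (q i) := by
  have hex : ∀ i, ∃ x y, ¬ T.Adj u x ∧ ((x = f i ∧ y = g i) ∨ (x = g i ∧ y = f i)) := by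
    intro i
    by_cases hu : T.Adj u (f i)
    · exact ⟨g i, f i, fun hu' => hT.not_adj_of_common_neighbor hu hu' (h.adj i),
        Or.inr ⟨rfl, rfl⟩⟩
    · exact ⟨f i, g i, hu, Or.inl ⟨rfl, rfl⟩⟩
  choose q p hq hqp using hex
  refine ⟨q, p, ⟨fun i => ?_, fun i j hij => ?_, fun i j hij => ?_, fun i j hij => ?_⟩, hq⟩
  · rcases hqp i with hi | hi <;> rw [hi.1, hi.2]
    · exact h.adj i
    · exact (h.adj i).symm
  · rcases hqp i with hi | hi <;> rcases hqp j with hj | hj <;> rw [hi.1, hj.1] at hij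
    · exact h.left_injective i j hij
    · exact absurd hij (h.ne i j)
    · exact absurd hij.symm (h.ne j i)
    · exact h.right_injective i j hij
  · rcases hqp i with hi | hi <;> rcases hqp j with hj | hj <;> rw [hi.2, hj.2] at hij
    · exact h.right_injective i j hij
    · exact absurd hij.symm (h.ne j i)
    · exact absurd hij (h.ne i j)
    · exact h.left_injective i j hij
  · rcases hqp i with hi | hi <;> rcases hqp j with hj | hj <;> rw [hi.1, hj.2] at hij
    · exact h.ne i j hij
    · obtain rfl := h.left_injective i j hij
      exact h.ne i i (hi.1.symm.trans hj.1)
    · obtain rfl := h.right_injective i j hij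
      exact h.ne i i (hj.1.symm.trans hi.1)
    · exact h.ne j i hij.symm

lemma HasMatching.degree_add_le [Fintype V] [DecidableRel T.Adj] (h : T.HasMatching b)
    (hT : T.IsTree) (u : V) : T.degree u + b ≤ Fintype.card V := by
  classical
  obtain ⟨f, g, h⟩ := h
  obtain ⟨q, p, hqp, hqu⟩ := h.exists_not_adj hT u
  have hsub : Finset.univ.image q ⊆ (T.neighborFinset u)ᶜ := by
    intro x hx
    obtain ⟨i, -, rfl⟩ := Finset.mem_image.1 hx
    simpa using hqu i
  have hcard := Finset.card_le_card hsub
  rw [Finset.card_image_of_injective _ hqp.left_injective, Finset.card_univ, Fintype.card_fin,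
    Finset.card_compl, card_neighborFinset_eq_degree] at hcard
  have := (T.degree_lt_card_verts u).le
  omega

/-- The edge of a matching that covers a leaf is the edge at that leaf. -/
lemma IsIndexedMatching.covers_of_leaf {ι : Type*} {f g : ι → V} (h : T.IsIndexedMatching f g)
    {u v : V} (hv : ∀ y, T.Adj v y ↔ y = u) {i : ι} (hi : f i = v ∨ g i = v) :
    (f i = v ∧ g i = u) ∨ (f i = u ∧ g i = v) := by
  rcases hi with hi | hi
  · exact Or.inl ⟨hi, (hv _).1 (hi ▸ h.adj i)⟩
  · exact Or.inr ⟨(hv _).1 (hi ▸ (h.adj i).symm), hi⟩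

lemma IsIndexedMatching.map {ι : Type*} {f g : ι → V} (h : T.IsIndexedMatching f g)
    (e : V ≃ V) (he : ∀ x y, T.Adj x y → T.Adj (e x) (e y)) :
    T.IsIndexedMatching (e ∘ f) (e ∘ g) where
  adj i := he _ _ (h.adj i)
  left_injective i j hij := h.left_injective i j (e.injective hij)
  right_injective i j hij := h.right_injective i j (e.injective hij)
  ne i j hij := h.ne i j (e.injective hij)

lemma swap_leaves_adj [DecidableEq V] {u v x : V} (hv : ∀ y, T.Adj v y ↔ y = u)
    (hx : ∀ y, T.Adj x y ↔ y = u) {y z : V} (h : T.Adj y z) :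
    T.Adj (Equiv.swap v x y) (Equiv.swap v x z) := by
  have key : ∀ y z, T.Adj y z → (y = v ∨ y = x) →
      T.Adj (Equiv.swap v x y) (Equiv.swap v x z) := by
    have huv : u ≠ v := ((hv u).2 rfl).ne'
    have hux : u ≠ x := ((hx u).2 rfl).ne'
    rintro y z h (rfl | rfl)
    · rw [(hv z).1 h, Equiv.swap_apply_left, Equiv.swap_apply_of_ne_of_ne huv hux, hx]
    · rw [(hx z).1 h, Equiv.swap_apply_right, Equiv.swap_apply_of_ne_of_ne huv hux, hv]
  by_cases hy : y = v ∨ y = x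
  · exact key y z h hy
  by_cases hz : z = v ∨ z = x
  · exact (key z y h.symm hz).symm
  push Not at hy hz
  rwa [Equiv.swap_apply_of_ne_of_ne hy.1 hy.2, Equiv.swap_apply_of_ne_of_ne hz.1 hz.2]

/-- One of two leaves with a common neighbour can be avoided by a matching. -/
lemma HasMatching.avoid_twin_leaf (h : T.HasMatching b) {u v x : V} (hxv : x ≠ v)
    (hv : ∀ y, T.Adj v y ↔ y = u) (hx : ∀ y, T.Adj x y ↔ y = u) :
    T.HasMatchingOn {v}ᶜ b := by
  classical
  obtain ⟨f, g, h⟩ := h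
  by_cases hcov : ∃ i, f i = v ∨ g i = v
  · obtain ⟨i, hi⟩ := hcov
    have hxcov : ∀ j, ¬ (f j = x ∨ g j = x) := by
      intro j hj
      rcases h.covers_of_leaf hv hi with hi | hi <;>
        rcases h.covers_of_leaf hx hj with hj | hj
      · have := h.right_injective i j (hi.2.trans hj.2.symm)
        subst this
        exact hxv (hj.1.symm.trans hi.1)
      · exact h.ne j i (hj.1.trans hi.2.symm)
      · exact h.ne i j (hi.1.trans hj.2.symm)
      · have := h.left_injective i j (hi.1.trans hj.1.symm)
        subst this
        exact hxv (hj.2.symm.trans hi.2)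
    refine ⟨_, _, h.map (Equiv.swap v x) fun _ _ => swap_leaves_adj hv hx, fun j => ?_⟩
    have := hxcov j
    push Not at this
    simpa [Equiv.swap_apply_eq_iff] using this
  · push Not at hcov
    exact ⟨f, g, h, hcov⟩

/-- A leaf and its neighbour can be avoided by giving up one edge of a matching. -/
lemma HasMatching.avoid_leaf_edge (h : T.HasMatching (b + 1)) {u v : V}
    (hv : ∀ y, T.Adj v y ↔ y = u) : T.HasMatchingOn {u, v}ᶜ b := by
  obtain ⟨f, g, h⟩ := h
  obtain ⟨k, hk⟩ : ∃ k, ∀ i, i ≠ k → f i ≠ u ∧ g i ≠ u := by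
    by_cases hcov : ∃ k, f k = u ∨ g k = u
    · obtain ⟨k, hk⟩ := hcov
      refine ⟨k, fun i hik => ⟨fun hi => ?_, fun hi => ?_⟩⟩ <;> rcases hk with hk | hk
      · exact hik (h.left_injective i k (hi.trans hk.symm))
      · exact h.ne i k (hi.trans hk.symm)
      · exact h.ne k i (hk.trans hi.symm)
      · exact hik (h.right_injective i k (hi.trans hk.symm))
    · push Not at hcov
      exact ⟨0, fun i _ => hcov i⟩
  refine ⟨f ∘ k.succAbove, g ∘ k.succAbove, ⟨fun i => h.adj _, ?_, ?_, fun i j => h.ne _ _⟩, ?_⟩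
  · exact fun i j hij => Fin.succAbove_right_injective (h.left_injective _ _ hij)
  · exact fun i j hij => Fin.succAbove_right_injective (h.right_injective _ _ hij)
  · intro i
    have hu := hk (k.succAbove i) (Fin.succAbove_ne k i)
    have hncov : ¬ (f (k.succAbove i) = v ∨ g (k.succAbove i) = v) := by
      intro hcov
      rcases h.covers_of_leaf hv hcov with hc | hc
      · exact hu.2 hc.2
      · exact hu.1 hc.1
    push Not at hncov
    simp [hu, hncov]

lemma Subgraph.IsMatching.hasMatching {M : T.Subgraph} (hM : M.IsMatching)
    (hfin : M.edgeSet.Finite) : T.HasMatching M.edgeSet.ncard := by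
  have := hfin.fintype
  let e : Fin M.edgeSet.ncard ≃ M.edgeSet :=
    (Finite.equivFinOfCardEq (Nat.card_coe_set_eq _)).symm
  have hrep : ∀ i, ∃ x y, (e i : Sym2 V) = s(x, y) ∧ M.Adj x y := by
    intro i
    obtain ⟨p, hp⟩ := e i
    induction p with
    | _ x y => exact ⟨x, y, rfl, hp⟩
  choose f g hfg hadj using hrep
  have huniq : ∀ i j x, (f i = x ∨ g i = x) → (f j = x ∨ g j = x) → i = j := by
    intro i j x hi hj
    apply e.injective
    apply Subtype.ext
    have hmem : ∀ i, (f i = x ∨ g i = x) → ∃ y, (e i : Sym2 V) = s(x, y) ∧ M.Adj x y := by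
      rintro i (rfl | rfl)
      · exact ⟨_, hfg i, hadj i⟩
      · exact ⟨_, (hfg i).trans Sym2.eq_swap, (hadj i).symm⟩
    obtain ⟨y, hy, hxy⟩ := hmem i hi
    obtain ⟨z, hz, hxz⟩ := hmem j hj
    rw [hy, hz, (hM hxy.fst_mem).unique hxy hxz]
  refine ⟨f, g, fun i => (hadj i).adj_sub, fun i j hij => ?_, fun i j hij => ?_, fun i j hij => ?_⟩
  · exact huniq i j _ (Or.inl hij) (Or.inl rfl)
  · exact huniq i j _ (Or.inr hij) (Or.inr rfl)
  · obtain rfl := huniq i j _ (Or.inl hij) (Or.inr rfl)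
    exact (hadj i).ne hij

lemma bddAbove_setOf_isMatching_ncard [Finite V] (G : SimpleGraph V) :
    BddAbove {k : ℕ | ∃ M : G.Subgraph, M.IsMatching ∧ M.edgeSet.ncard = k} := by
  refine ⟨Nat.card (Sym2 V), ?_⟩
  rintro k ⟨M, -, rfl⟩
  exact Set.ncard_le_card _

lemma hasMatching_matchingNumber [Finite V] (G : SimpleGraph V) :
    G.HasMatching G.matchingNumber := by
  obtain ⟨M, hM, hcard⟩ : G.matchingNumber ∈
      {k : ℕ | ∃ M : G.Subgraph, M.IsMatching ∧ M.edgeSet.ncard = k} :=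
    Nat.sSup_mem ⟨_, ⊥, fun v hv => hv.elim, rfl⟩ G.bddAbove_setOf_isMatching_ncard
  rw [← hcard]
  exact hM.hasMatching (Set.toFinite _)

lemma Connected.one_le_matchingNumber [Finite V] [Nontrivial V] (hT : T.Connected) :
    1 ≤ T.matchingNumber := by
  obtain ⟨x, y, hxy⟩ := exists_pair_ne V
  obtain ⟨z, hz, -⟩ := hT.exists_adj_dist_add_one hxy
  exact le_csSup T.bddAbove_setOf_isMatching_ncard
    ⟨T.subgraphOfAdj hz, .subgraphOfAdj hz, by simp⟩

end Matching

section Bound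

open scoped Classical in
lemma sum_eq_add_sum_compl_singleton {V M : Type*} [Fintype V] [AddCommMonoid M] (v : V)
    [Fintype ({v}ᶜ : Set V)] (f : V → M) :
    ∑ x, f x = f v + ∑ x : ({v}ᶜ : Set V), f x := by
  rw [Fintype.sum_eq_add_sum_subtype_ne f v]
  congr 1
  exact Fintype.sum_equiv (Equiv.subtypeEquivRight fun x => by simp) _ _ fun x => rfl

lemma IsTree.hararyIndex_eq_add_induce {V : Type*} [Fintype V] {T : SimpleGraph V}
    (hT : T.IsTree) {u v : V} [Fintype ({v}ᶜ : Set V)] (hv : ∀ y, T.Adj v y ↔ y = u) :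
    T.hararyIndex = ∑ x, 1 / (T.dist v x : ℝ) + (T.induce {v}ᶜ).hararyIndex := by
  have hrow : ∀ x, ∑ y, 1 / (T.dist x y : ℝ) =
      1 / (T.dist v x : ℝ) + ∑ y : ({v}ᶜ : Set V), 1 / (T.dist x y : ℝ) := by
    intro x
    rw [sum_eq_add_sum_compl_singleton v, T.dist_comm]
  unfold hararyIndex
  simp only [hT.dist_induce (hT.induce_compl_leaf hv)]
  rw [sum_eq_add_sum_compl_singleton v (fun x => ∑ y, 1 / (T.dist x y : ℝ)),
    Finset.sum_congr rfl fun (x : ({v}ᶜ : Set V)) _ => hrow x, Finset.sum_add_distrib]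
  have h := sum_eq_add_sum_compl_singleton v (fun x => 1 / (T.dist v x : ℝ))
  simp only [dist_self, Nat.cast_zero, div_zero, zero_add] at h
  rw [h]
  ring

variable {V : Type*} [Fintype V] {T : SimpleGraph V}

open scoped Classical in
lemma sum_indicator_vertex (u : V) (c : ℝ) : ∑ x : V, (if x = u then c else 0) = c := by simp

open scoped Classical in
lemma sum_indicator_adj (u : V) (c : ℝ) :
    ∑ x : V, (if T.Adj u x then c else 0) = c * T.degree u := by
  rw [← Finset.sum_filter, Finset.sum_const, nsmul_eq_mul, mul_comm,
    ← neighborFinset_eq_filter, card_neighborFinset_eq_degree]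

lemma one_div_add_le {c d : ℕ} (hd : c < d) (k : ℕ) :
    1 / ((d + k : ℕ) : ℝ) ≤ 1 / ((c + 1 + k : ℕ) : ℝ) := by
  gcongr
  omega

open scoped Classical in
lemma IsTree.sum_one_div_dist_le_of_leaf (hT : T.IsTree) {u v : V}
    (hv : ∀ y, T.Adj v y ↔ y = u) :
    ∑ x, 1 / (T.dist v x : ℝ) ≤ (Fintype.card V : ℝ) / 3 + 1 / 6 + T.degree u / 6 := by
  have huv : T.Adj u v := ((hv u).2 rfl).symm
  let F : V → ℝ := fun x => 1 / 3 + (if x = u then 2 / 3 else 0) +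
    (if T.Adj u x then 1 / 6 else 0) + (if x = v then -1 / 2 else 0)
  have hF : ∑ x, F x = (Fintype.card V : ℝ) / 3 + 1 / 6 + T.degree u / 6 := by
    simp only [F, Finset.sum_add_distrib, sum_indicator_vertex, sum_indicator_adj,
      Finset.sum_const, Finset.card_univ, nsmul_eq_mul]
    ring
  have hpt : ∀ x, 1 / (T.dist v x : ℝ) ≤ F x := by
    intro x
    by_cases hxv : x = v
    · subst hxv
      simp [F, huv, huv.ne']
      norm_num
    · rw [hT.connected.dist_of_leaf hv hxv]
      by_cases hxu : x = u
      · subst hxu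
        simp [F, hxv]
        norm_num
      · by_cases hadj : T.Adj u x
        · have := dist_eq_one_iff_adj.2 hadj
          simp [F, hxv, hxu, hadj, this]
          norm_num
        · have h2 := hT.connected.one_lt_dist_of_ne_of_not_adj (Ne.symm hxu) hadj
          have hFx : F x = 1 / ((1 + 1 + 1 : ℕ) : ℝ) := by
            simp [F, hxv, hxu, hadj]
          rw [hFx]
          exact one_div_add_le h2 1
  rw [← hF]
  exact Finset.sum_le_sum fun x _ => hpt x

open scoped Classical in
lemma IsTree.sum_one_div_dist_le_of_pendant_path (hT : T.IsTree) {u v w : V}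
    (hv : ∀ y, T.Adj v y ↔ y = u) (hwv : w ≠ v) (hu : ∀ y, T.Adj u y ↔ y = v ∨ y = w) :
    ∑ x, 1 / (T.dist v x : ℝ) ≤ (Fintype.card V : ℝ) / 4 + 2 / 3 + T.degree w / 12 := by
  have hvu : T.Adj v u := (hv u).2 rfl
  have hwu : T.Adj w u := ((hu w).2 (Or.inr rfl)).symm
  have hwv' : ¬ T.Adj w v := fun h => hwu.ne ((hv w).1 h.symm)
  let F : V → ℝ := fun x => 1 / 4 + (if x = w then 1 / 4 else 0) +
    (if T.Adj w x then 1 / 12 else 0) + (if x = u then 2 / 3 else 0) +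
    (if x = v then -1 / 4 else 0)
  have hF : ∑ x, F x = (Fintype.card V : ℝ) / 4 + 2 / 3 + T.degree w / 12 := by
    simp only [F, Finset.sum_add_distrib, sum_indicator_vertex, sum_indicator_adj,
      Finset.sum_const, Finset.card_univ, nsmul_eq_mul]
    ring
  have hpt : ∀ x, 1 / (T.dist v x : ℝ) ≤ F x := by
    intro x
    by_cases hxv : x = v
    · subst hxv
      simp [F, hwv.symm, hwv', hvu.ne]
      norm_num
    · by_cases hxu : x = u
      · subst hxu
        have := dist_eq_one_iff_adj.2 hvu
        simp [F, hxv, hwu, hwu.ne', this]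
        norm_num
      · have hux : T.dist u x = T.dist w x + 1 := by
          obtain ⟨z, hz, hzx⟩ := hT.connected.exists_adj_dist_add_one (Ne.symm hxu)
          rcases (hu z).1 hz with rfl | rfl
          · have := hT.connected.dist_of_leaf hv hxv
            omega
          · exact hzx.symm
        rw [hT.connected.dist_of_leaf hv hxv, hux]
        by_cases hxw : x = w
        · subst hxw
          simp [F, hxv, hxu]
          norm_num
        · by_cases hadj : T.Adj w x
          · have := dist_eq_one_iff_adj.2 hadj
            simp [F, hxv, hxu, hxw, hadj, this]
            norm_num
          · have h2 := hT.connected.one_lt_dist_of_ne_of_not_adj (Ne.symm hxw) hadj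
            have hFx : F x = 1 / ((1 + 1 + 2 : ℕ) : ℝ) := by
              simp [F, hxv, hxw, hxu, hadj]
            rw [hFx]
            exact one_div_add_le h2 2
  rw [← hF]
  exact Finset.sum_le_sum fun x _ => hpt x

/-- The Harary index of a spur on `n` vertices with matching number `b`. -/
noncomputable def hararyBound (n b : ℝ) : ℝ :=
  (6 * n ^ 2 - 4 * b * n + b ^ 2 + 9 * b + 10 * n - 22) / 24

open scoped Classical in
/-- The bound for the Harary index, with the maximum degree forced by equality. -/
def HararyBounded (T : SimpleGraph V) (b : ℕ) : Prop :=
  T.hararyIndex ≤ hararyBound (Fintype.card V) b ∧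
    (T.hararyIndex = hararyBound (Fintype.card V) b →
      ∃ c, T.degree c + b = Fintype.card V)

open scoped Classical in
lemma cast_card_compl_singleton (v : V) [Fintype ({v}ᶜ : Set V)] :
    (Fintype.card ({v}ᶜ : Set V) : ℝ) = Fintype.card V - 1 := by
  have h := sum_eq_add_sum_compl_singleton v (fun _ => (1 : ℝ))
  simp only [Finset.sum_const, Finset.card_univ, nsmul_eq_mul, mul_one] at h
  linarith

open scoped Classical in
lemma HasMatching.cast_degree_add_le {b : ℕ} (h : T.HasMatching b) (hT : T.IsTree) (u : V) :
    (T.degree u : ℝ) + b ≤ Fintype.card V := by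
  exact_mod_cast h.degree_add_le hT u

lemma hararyIndex_of_subsingleton [Subsingleton V] : T.hararyIndex = 0 := by
  have hd : ∀ x y, T.dist x y = 0 := fun x y => by rw [Subsingleton.elim x y, dist_self]
  simp [hararyIndex, hd]

open scoped Classical in
lemma IsTree.hararyBounded_of_leaf (hT : T.IsTree) {b : ℕ} (hb : T.HasMatching b) {u v : V}
    (hv : ∀ y, T.Adj v y ↔ y = u)
    (ih : (T.induce {v}ᶜ).hararyIndex ≤ hararyBound (Fintype.card ({v}ᶜ : Set V)) b) :
    T.HararyBounded b := by
  have hrow := hT.sum_one_div_dist_le_of_leaf hv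
  have hsplit := hT.hararyIndex_eq_add_induce hv
  have hdeg := hb.cast_degree_add_le hT u
  rw [cast_card_compl_singleton v] at ih
  unfold HararyBounded
  unfold hararyBound at *
  refine ⟨by linarith, fun h => ⟨u, ?_⟩⟩
  exact_mod_cast (by linarith : (T.degree u : ℝ) + b = Fintype.card V)

open scoped Classical in
lemma IsTree.hararyBounded_of_pendant_path (hT : T.IsTree) {b : ℕ}
    (hb : T.HasMatching (b + 1)) {u v w : V} (hv : ∀ y, T.Adj v y ↔ y = u) (hwv : w ≠ v)
    (hu : ∀ y, T.Adj u y ↔ y = v ∨ y = w) {u' : ({v}ᶜ : Set V)} (huu' : (u' : V) = u)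
    (ih : ((T.induce {v}ᶜ).induce {u'}ᶜ).hararyIndex ≤
      hararyBound (Fintype.card ({u'}ᶜ : Set ({v}ᶜ : Set V))) b) :
    T.HararyBounded (b + 1) := by
  have hT' := hT.induce_compl_leaf hv
  have hu' : ∀ y : ({v}ᶜ : Set V), (T.induce {v}ᶜ).Adj u' y ↔ y = ⟨w, hwv⟩ := by
    rintro ⟨y, hy⟩
    have hyv : y ≠ v := hy
    rw [Subtype.ext_iff]
    simp [huu', hu, hyv]
  have hb' : (T.induce {v}ᶜ).HasMatching b := by
    obtain ⟨f, g, h, hs⟩ := hb.avoid_leaf_edge hv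
    exact HasMatchingOn.induce ⟨f, g, h, fun i => by
      have := hs i
      simp only [Set.mem_compl_iff, Set.mem_insert_iff, Set.mem_singleton_iff, not_or] at this ⊢
      exact ⟨this.1.2, this.2.2⟩⟩
  have hrow := hT.sum_one_div_dist_le_of_pendant_path hv hwv hu
  have hrow' := hT'.sum_one_div_dist_le_of_leaf hu'
  have hsplit := hT.hararyIndex_eq_add_induce hv
  have hsplit' := hT'.hararyIndex_eq_add_induce hu'
  have hdeg := hb.cast_degree_add_le hT w
  have hdeg' := hb'.cast_degree_add_le hT' ⟨w, hwv⟩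
  rw [cast_card_compl_singleton u', cast_card_compl_singleton v] at ih
  rw [cast_card_compl_singleton v] at hdeg' hrow'
  unfold HararyBounded
  unfold hararyBound at *
  push_cast at hdeg ⊢
  refine ⟨by linarith, fun h => ⟨w, ?_⟩⟩
  exact_mod_cast (by linarith : (T.degree w : ℝ) + (b + 1) = Fintype.card V)

end Bound

theorem IsTree.hararyBounded {V : Type*} [Fintype V] {T : SimpleGraph V} (hT : T.IsTree) {b : ℕ}
    (hb1 : 1 ≤ b) (hb : T.HasMatching b) : T.HararyBounded b := by
  classical
  induction hn : Fintype.card V using Nat.strong_induction_on generalizing V b with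
  | _ n ih =>
    subst hn
    have hcard := hb.two_mul_le
    have : Nontrivial V := Fintype.one_lt_card_iff_nontrivial.1 (by omega)
    have hlt : ∀ v : V, Fintype.card ({v}ᶜ : Set V) + 1 = Fintype.card V := by
      intro v
      have := cast_card_compl_singleton v
      exact_mod_cast (by linarith : (Fintype.card ({v}ᶜ : Set V) + 1 : ℝ) = Fintype.card V)
    have leaf : ∀ {u v : V} (hv : ∀ y, T.Adj v y ↔ y = u),
        (T.induce {v}ᶜ).HasMatching b → T.HararyBounded b := fun {u v} hv hb' =>
      hT.hararyBounded_of_leaf hb hv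
        (ih _ (by have := hlt v; omega) (hT.induce_compl_leaf hv) hb1 hb' rfl).1
    by_cases h3 : 3 ≤ Fintype.card V
    · obtain ⟨u, v, hv, ⟨x, hxv, hx⟩ | ⟨w, hwv, hu, x, hxu, hwx⟩⟩ :=
        hT.exists_twin_leaf_or_pendant_path (by rwa [Nat.card_eq_fintype_card])
      · exact leaf hv (hb.avoid_twin_leaf hxv hv hx).induce
      · obtain rfl | ⟨k, rfl⟩ : b = 1 ∨ ∃ k, b = k + 1 + 1 := by
          rcases b with _ | _ | k
          · omega
          · exact Or.inl rfl
          · exact Or.inr ⟨k, rfl⟩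
        · have : Nontrivial ({v}ᶜ : Set V) :=
            Fintype.one_lt_card_iff_nontrivial.1 (by have := hlt v; omega)
          exact leaf hv (hT.induce_compl_leaf hv).connected.hasMatching_one
        · have huv : u ≠ v := ((hv u).2 rfl).ne'
          have hb' : ((T.induce {v}ᶜ).induce {⟨u, huv⟩}ᶜ).HasMatching (k + 1) := by
            refine HasMatchingOn.induce ?_
            have := (hb.avoid_leaf_edge hv).induce_of_subset (s := {v}ᶜ) (by simp)
            obtain ⟨f, g, h, hs⟩ := this
            refine ⟨f, g, h, fun i => ?_⟩
            have := hs i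
            simp only [Set.mem_preimage, Set.mem_compl_iff, Set.mem_insert_iff,
              Set.mem_singleton_iff, not_or, Subtype.ext_iff] at this ⊢
            exact ⟨this.1.1, this.2.1⟩
          refine hT.hararyBounded_of_pendant_path hb hv hwv hu (u' := ⟨u, huv⟩) rfl ?_
          have hu' : ∀ y : ({v}ᶜ : Set V), (T.induce {v}ᶜ).Adj ⟨u, huv⟩ y ↔ y = ⟨w, hwv⟩ := by
            rintro ⟨y, hy⟩
            have hyv : y ≠ v := hy
            rw [Subtype.ext_iff]
            simp [hu, hyv]
          have h1 := hlt v
          have h2 : Fintype.card ({⟨u, huv⟩}ᶜ : Set ({v}ᶜ : Set V)) < Fintype.card V :=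
            (set_fintype_card_le_univ _).trans_lt (by omega)
          exact (ih _ h2 ((hT.induce_compl_leaf hv).induce_compl_leaf hu') (by omega) hb' rfl).1
    · have hV : Fintype.card V = 2 := by omega
      obtain rfl : b = 1 := by omega
      obtain ⟨r⟩ : Nonempty V := inferInstance
      obtain ⟨v, hv⟩ := Finite.exists_max (fun x => T.dist x r)
      obtain ⟨u, hu⟩ := hT.exists_leaf_of_forall_dist_le hv
      have h1 : Fintype.card ({v}ᶜ : Set V) = 1 := by
        have := hlt v
        omega
      have : Subsingleton ({v}ᶜ : Set V) := Fintype.card_le_one_iff_subsingleton.1 h1.le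
      refine hT.hararyBounded_of_leaf hb hu ?_
      rw [hararyIndex_of_subsingleton, h1, hararyBound]
      norm_num

section Spur

variable {V : Type*} {T : SimpleGraph V} {m k : ℕ}

/-- A labelling of the vertices of `T` by a center, its `m` neighbours, and `k` pendent vertices
attached to different ones of these neighbours. -/
structure IsSpurLabelling (T : SimpleGraph V) (hk : k ≤ m)
    (φ : Fin 1 ⊕ Fin m ⊕ Fin k ≃ V) : Prop where
  adj_center : ∀ i, T.Adj (φ (.inl 0)) (φ (.inr (.inl i)))
  adj_pendent : ∀ j, T.Adj (φ (.inr (.inl (Fin.castLE hk j)))) (φ (.inr (.inr j)))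

/-- The distances in a spur. -/
def spurDist (hk : k ≤ m) : Fin 1 ⊕ Fin m ⊕ Fin k → Fin 1 ⊕ Fin m ⊕ Fin k → ℕ
  | .inl _, .inl _ => 0
  | .inl _, .inr (.inl _) => 1
  | .inl _, .inr (.inr _) => 2
  | .inr (.inl _), .inl _ => 1
  | .inr (.inr _), .inl _ => 2
  | .inr (.inl i), .inr (.inl j) => if i = j then 0 else 2
  | .inr (.inl i), .inr (.inr j) => if i = Fin.castLE hk j then 1 else 3
  | .inr (.inr j), .inr (.inl i) => if i = Fin.castLE hk j then 1 else 3
  | .inr (.inr i), .inr (.inr j) => if i = j then 0 else 4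

lemma IsSpurLabelling.dist_eq {hk : k ≤ m} {φ : Fin 1 ⊕ Fin m ⊕ Fin k ≃ V}
    (h : T.IsSpurLabelling hk φ) (hT : T.IsTree) (x y : Fin 1 ⊕ Fin m ⊕ Fin k) :
    T.dist (φ x) (φ y) = spurDist hk x y := by
  have hcz : ∀ j, T.dist (φ (.inl 0)) (φ (.inr (.inr j))) = 2 := fun j =>
    hT.dist_eq_length_of_isPath
      (.cons (h.adj_center (Fin.castLE hk j)) (.cons (h.adj_pendent j) .nil)) (by simp)
  have haz : ∀ i j, T.dist (φ (.inr (.inl i))) (φ (.inr (.inr j))) =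
      if i = Fin.castLE hk j then 1 else 3 := by
    intro i j
    split_ifs with hij
    · rw [hij, dist_eq_one_iff_adj]
      exact h.adj_pendent j
    · exact hT.dist_eq_length_of_isPath
        (.cons (h.adj_center i).symm (.cons (h.adj_center (Fin.castLE hk j))
          (.cons (h.adj_pendent j) .nil))) (by simp [hij])
  rcases x with x | i | i <;> rcases y with y | j | j
  · simp [spurDist, Subsingleton.elim x y]
  · rw [Subsingleton.elim x 0]
    exact dist_eq_one_iff_adj.2 (h.adj_center j)
  · rw [Subsingleton.elim x 0]
    exact hcz j
  · rw [Subsingleton.elim y 0]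
    exact dist_eq_one_iff_adj.2 (h.adj_center i).symm
  · change _ = if i = j then 0 else 2
    split_ifs with hij
    · rw [hij, dist_self]
    · exact hT.dist_eq_length_of_isPath
        (.cons (h.adj_center i).symm (.cons (h.adj_center j) .nil)) (by simp [hij])
  · exact haz i j
  · rw [Subsingleton.elim y 0, dist_comm]
    exact hcz i
  · rw [dist_comm]
    exact haz j i
  · change _ = if i = j then 0 else 4
    split_ifs with hij
    · rw [hij, dist_self]
    · exact hT.dist_eq_length_of_isPath
        (.cons (h.adj_pendent i).symm (.cons (h.adj_center (Fin.castLE hk i)).symm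
          (.cons (h.adj_center (Fin.castLE hk j)) (.cons (h.adj_pendent j) .nil))))
        (by simp [hij])

lemma sum_ite_eq_else {ι : Type*} [Fintype ι] [DecidableEq ι] (i : ι) (p q : ℝ) :
    ∑ j, (if i = j then p else q) = p + (Fintype.card ι - 1) * q := by
  have : ∀ j, (if i = j then p else q) = q + if i = j then p - q else 0 := by
    intro j
    split_ifs <;> ring
  simp only [this, Finset.sum_add_distrib, Finset.sum_const, Finset.card_univ, nsmul_eq_mul,
    Finset.sum_ite_eq, Finset.mem_univ, if_true]
  ring

lemma sum_spurDist (hk : k ≤ m) : ∑ x, ∑ y, 1 / (spurDist hk x y : ℝ) =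
    2 * hararyBound ((1 + (m + k) : ℕ) : ℝ) ((k + 1 : ℕ) : ℝ) := by
  have hite : ∀ (p : Prop) [Decidable p] (a b : ℕ),
      1 / ((if p then a else b : ℕ) : ℝ) = if p then 1 / (a : ℝ) else 1 / (b : ℝ) := by
    intro p _ a b
    split_ifs <;> rfl
  simp only [Fintype.sum_sum_type, spurDist, hite, Finset.sum_add_distrib, sum_ite_eq_else]
  rw [Finset.sum_comm (s := (Finset.univ : Finset (Fin m))) (t := (Finset.univ : Finset (Fin k)))]
  have hcol : ∀ j : Fin k, ∑ i : Fin m, (if i = Fin.castLE hk j then 1 / ((1 : ℕ) : ℝ)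
      else 1 / ((3 : ℕ) : ℝ)) = 1 + (m - 1) / 3 := by
    intro j
    simp only [eq_comm (b := Fin.castLE hk j), sum_ite_eq_else]
    simp
    ring
  simp only [hcol]
  simp [hararyBound]
  ring

lemma IsSpurLabelling.hararyIndex_eq [Fintype V] {hk : k ≤ m} {φ : Fin 1 ⊕ Fin m ⊕ Fin k ≃ V}
    (h : T.IsSpurLabelling hk φ) (hT : T.IsTree) :
    T.hararyIndex = hararyBound ((1 + (m + k) : ℕ) : ℝ) ((k + 1 : ℕ) : ℝ) := by
  have hsum : ∑ u, ∑ v, 1 / (T.dist u v : ℝ) = ∑ x, ∑ y, 1 / (spurDist hk x y : ℝ) := by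
    rw [← φ.sum_comp]
    refine Finset.sum_congr rfl fun x _ => ?_
    rw [← φ.sum_comp]
    exact Finset.sum_congr rfl fun y _ => by rw [h.dist_eq hT]
  rw [hararyIndex, hsum, sum_spurDist]
  ring

/-- The vertices of `spur (1 + (m + k)) m`, sorted by their distance to the center. -/
def spurIndex (m k : ℕ) : Fin 1 ⊕ Fin m ⊕ Fin k ≃ Fin (1 + (m + k)) :=
  ((Equiv.refl _).sumCongr finSumFinEquiv).trans finSumFinEquiv

lemma spur_adj_spurIndex_iff (hk : k ≤ m) (x y : Fin 1 ⊕ Fin m ⊕ Fin k) :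
    (spur (1 + (m + k)) m).Adj (spurIndex m k x) (spurIndex m k y) ↔ spurDist hk x y = 1 := by
  unfold spur
  rw [fromRel_adj, Ne, (spurIndex m k).injective.eq_iff]
  rcases x with x | i | i <;> rcases y with y | j | j <;>
    simp [spurIndex, spurDist, Fin.ext_iff, Subsingleton.elim _ (0 : Fin 1)] <;>
    grind

lemma IsSpurLabelling.nonempty_iso {hk : k ≤ m} {φ : Fin 1 ⊕ Fin m ⊕ Fin k ≃ V}
    (h : T.IsSpurLabelling hk φ) (hT : T.IsTree) :
    Nonempty (T ≃g spur (1 + (m + k)) m) := by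
  refine ⟨⟨φ.symm.trans (spurIndex m k), fun {x y} => ?_⟩⟩
  simp only [Equiv.trans_apply]
  rw [spur_adj_spurIndex_iff hk, ← h.dist_eq hT, dist_eq_one_iff_adj]
  simp

lemma Iso.isSpurLabelling (hk : k ≤ m) (e : T ≃g spur (1 + (m + k)) m) :
    T.IsSpurLabelling hk ((spurIndex m k).trans e.symm.toEquiv) where
  adj_center i := by
    refine (Iso.map_adj_iff e.symm).2 ((spur_adj_spurIndex_iff hk _ _).2 ?_)
    simp [spurDist]
  adj_pendent j := by
    refine (Iso.map_adj_iff e.symm).2 ((spur_adj_spurIndex_iff hk _ _).2 ?_)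
    simp [spurDist]

/-- A tree with a matching of size `k + 1` and a vertex of the largest possible degree is a
spur. -/
lemma IsTree.exists_isSpurLabelling [Fintype V] [DecidableRel T.Adj] (hT : T.IsTree)
    (hb : T.HasMatching (k + 1)) {c : V} (hc : T.degree c + (k + 1) = Fintype.card V) :
    ∃ (hk : k ≤ T.degree c) (φ : Fin 1 ⊕ Fin (T.degree c) ⊕ Fin k ≃ V),
      T.IsSpurLabelling hk φ := by
  classical
  obtain ⟨f, g, h⟩ := hb
  obtain ⟨q, p, hqp, hq⟩ := h.exists_not_adj hT c
  have himage : Finset.univ.image q = (T.neighborFinset c)ᶜ := by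
    refine Finset.eq_of_subset_of_card_le ?_ ?_
    · intro x hx
      obtain ⟨i, -, rfl⟩ := Finset.mem_image.1 hx
      simpa using hq i
    · rw [Finset.card_image_of_injective _ hqp.left_injective, Finset.card_univ,
        Fintype.card_fin, Finset.card_compl, card_neighborFinset_eq_degree]
      omega
  have hrange : ∀ x, ¬ T.Adj c x → ∃ i, q i = x := by
    intro x hx
    have : x ∈ Finset.univ.image q := by
      rw [himage]
      simpa using hx
    simpa using this
  have hp : ∀ i, T.Adj c (p i) := by
    intro i
    by_contra hi
    obtain ⟨j, hj⟩ := hrange _ hi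
    exact hqp.ne j i hj
  obtain ⟨i₀, hi₀⟩ := hrange c T.irrefl
  have hcard : Fintype.card (Fin (T.degree c)) = (T.neighborFinset c).card := by simp
  have hk : k ≤ T.degree c := by
    have := Finset.card_le_card (s := Finset.univ.image p) (t := T.neighborFinset c) (by
      intro x hx
      obtain ⟨i, -, rfl⟩ := Finset.mem_image.1 hx
      simpa using hp i)
    rw [Finset.card_image_of_injective _ hqp.right_injective, Finset.card_univ,
      Fintype.card_fin, card_neighborFinset_eq_degree] at this
    omega
  obtain ⟨a, ha⟩ := Finset.exists_equiv_extend_of_card_eq hcard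
    (s := Finset.univ.image (Fin.castLE hk))
    (f := fun i => if hi : i.val < k then p (i₀.succAbove ⟨i, hi⟩) else c) (by
      intro x hx
      simp only [Finset.mem_image, Finset.mem_univ, true_and, exists_exists_eq_and] at hx
      obtain ⟨j, rfl⟩ := hx
      simpa using hp _) (by
      intro x hx y hy hxy
      simp only [Finset.coe_image, Finset.coe_univ, Set.image_univ, Set.mem_range] at hx hy
      obtain ⟨i, rfl⟩ := hx
      obtain ⟨j, rfl⟩ := hy
      simp only [Fin.val_castLE, Fin.is_lt, dif_pos] at hxy
      exact congrArg (Fin.castLE hk)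
        (Fin.succAbove_right_injective (hqp.right_injective _ _ hxy)))
  have hadj : ∀ i, T.Adj c (a i) := fun i => (T.mem_neighborFinset c _).1 (a i).2
  have hinj : Function.Injective (Sum.elim (fun _ : Fin 1 => c)
      (Sum.elim (fun i => (a i : V)) fun j => q (i₀.succAbove j))) := by
    refine Function.Injective.sumElim (fun _ _ _ => Subsingleton.elim _ _)
      (Function.Injective.sumElim ?_ ?_ ?_) ?_
    · exact Subtype.val_injective.comp a.injective
    · intro i j hij
      exact Fin.succAbove_right_injective (hqp.left_injective _ _ hij)
    · intro i j hij
      exact hq _ (hij ▸ hadj i)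
    · rintro - (i | j) hij
      · exact (hadj i).ne hij
      · exact Fin.succAbove_ne i₀ j (hqp.left_injective _ _ (hij.symm.trans hi₀.symm))
  have hbij := (Fintype.bijective_iff_injective_and_card _).2 ⟨hinj, by
    simp only [Fintype.card_sum, Fintype.card_fin]
    omega⟩
  refine ⟨hk, Equiv.ofBijective _ hbij, hadj, fun j => ?_⟩
  have haj := ha (Fin.castLE hk j) (by simp)
  simp only [Fin.val_castLE, Fin.is_lt, dif_pos] at haj
  simpa [haj] using (hqp.adj (i₀.succAbove j)).symm

end Spur

end SimpleGraph

theorem theorem3p4 {V : Type*} [Fintype V] (T : SimpleGraph V) (hT : T.IsTree)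
    (n β : ℕ) (hn : Fintype.card V = n) (hn2 : 2 ≤ n) (hβ : T.matchingNumber = β) :
    T.hararyIndex ≤
        (6 * (n : ℝ) ^ 2 - 4 * (β : ℝ) * (n : ℝ) + (β : ℝ) ^ 2 + 9 * (β : ℝ) + 10 * (n : ℝ) - 22) / 24 ∧
      (T.hararyIndex =
          (6 * (n : ℝ) ^ 2 - 4 * (β : ℝ) * (n : ℝ) + (β : ℝ) ^ 2 + 9 * (β : ℝ) + 10 * (n : ℝ) - 22) / 24 ↔
        Nonempty (T ≃g SimpleGraph.spur n (n - β))) := by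
  classical
  have : Nontrivial V := Fintype.one_lt_card_iff_nontrivial.1 (by omega)
  have hb : T.HasMatching β := hβ ▸ T.hasMatching_matchingNumber
  obtain ⟨k, rfl⟩ : ∃ k, β = k + 1 :=
    Nat.exists_eq_add_of_le' (hβ ▸ hT.connected.one_le_matchingNumber)
  have hle := hb.two_mul_le
  have hbound := hT.hararyBounded (Nat.le_add_left 1 k) hb
  rw [SimpleGraph.HararyBounded, hn] at hbound
  refine ⟨hbound.1, fun h => ?_, ?_⟩
  · obtain ⟨c, hc⟩ := hbound.2 h
    obtain ⟨hk, φ, hφ⟩ := hT.exists_isSpurLabelling hb (hc.trans hn.symm)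
    obtain rfl : n = 1 + (T.degree c + k) := by
      rw [← hn]
      have := Fintype.card_congr φ
      simpa using this.symm
    convert hφ.nonempty_iso hT using 3
    omega
  · rintro ⟨e⟩
    obtain ⟨m, rfl⟩ : ∃ m, n = 1 + (m + k) := ⟨n - (k + 1), by omega⟩
    have hm : 1 + (m + k) - (k + 1) = m := by omega
    rw [hm] at e
    exact (e.isSpurLabelling (by omega)).hararyIndex_eq hT
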